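/- Let $p \ge 2$ and $K > 0$ be real numbers. There is a constant $C > 0$, depending only on $p$ and $K$, such that the following holds. Let $\mathbb{B}$ be any real Banach space for which $\eta(\varepsilon) = K\varepsilon^p$ is a modulus of uniform convexity; that is, for every $\varepsilon \in (0,2]$ we have $\eta(\varepsilon) \in (0,1]$, and for all $x, y \in \mathbb{B}$ with $\|x\| \le 1$, $\|y\| \le 1$ and $\|x - y\| \ge \varepsilon$ we have $\|(x+y)/2\| \le 1 - \eta(\varepsilon)$. Let $\ell^p(\mathbb{B})$ be the space of functions $f : \mathbb{Z} \to \mathbb{B}$ with $\|f\|_{\ell^p(\mathbb{B})} = \bigl(\sum_{x \in \mathbb{Z}} \|f(x)\|^p\bigr)^{1/p} < \infty$, let $T$ be the shift operator $(Tf)(x) = f(x+1)$ on $\ell^p(\mathbb{B})$, and for $n \ge 1$ let $A_n f = \frac{1}{n}\sum_{i<n} T^i f$, so that $(A_n f)(x) = \frac1n \sum_{i<n} f(x+i)$. Then for every $f \in \ell^p(\mathbb{B})$ and every increasing (not necessarily strictly increasing) sequence $(t_k)_{k \in \mathbb{N}}$ of positive integers, $$\sum_{k} \| A_{t_{k+1}}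 f - A_{t_k} f \|_{\ell^p(\mathbb{B})}^p \le C \, \| f \|_{\ell^p(\mathbb{B})}^p ;$$ in particular the series on the left converges. -/

import Mathlib

open scoped ENNReal lp

noncomputable section

/-- `η` is a modulus of uniform convexity of `B`: for every `ε ∈ (0, 2]` we have `η ε ∈ (0, 1]`, and
any two points of the closed unit ball at distance at least `ε` have a midpoint of norm at most
`1 - η ε`. -/
def IsModulusOfUniformConvexity (B : Type*) [NormedAddCommGroup B] [NormedSpace ℝ B]
    (η : ℝ → ℝ) : Prop :=
  ∀ ε : ℝ, 0 < ε → ε ≤ 2 → 0 < η ε ∧ η ε ≤ 1 ∧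
    ∀ x y : B, ‖x‖ ≤ 1 → ‖y‖ ≤ 1 → ε ≤ ‖x - y‖ → ‖(1 / 2 : ℝ) • (x + y)‖ ≤ 1 - η ε

theorem memℓp_shift {B : Type*} [NormedAddCommGroup B] {p : ℝ≥0∞} {f : ℤ → B}
    (hf : Memℓp f p) : Memℓp (fun x : ℤ => f (x + 1)) p := by
  rcases p.trichotomy with rfl | rfl | hp
  · exact memℓp_zero
      ((memℓp_zero_iff.1 hf).preimage (f := fun x : ℤ => x + 1) (add_left_injective 1).injOn)
  · refine memℓp_infty ((memℓp_infty_iff.1 hf).mono ?_)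
    rintro _ ⟨x, rfl⟩
    exact ⟨x + 1, rfl⟩
  · exact memℓp_gen ((hf.summable hp).comp_injective (add_left_injective (1 : ℤ)))

/-- The operator `(T f)(x) = f (x + 1)` on `ℓ^p(ℤ; B)` induced by the shift `x ↦ x + 1` of `ℤ`. -/
def lpShift (B : Type*) [NormedAddCommGroup B] [NormedSpace ℝ B] (p : ℝ≥0∞) :
    lp (fun _ : ℤ => B) p →ₗ[ℝ] lp (fun _ : ℤ => B) p where
  toFun f := ⟨fun x : ℤ => f (x + 1), memℓp_shift (lp.memℓp f)⟩
  map_add' _ _ := rfl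
  map_smul' _ _ := rfl

/-- The ergodic average `A_n f = (1 / n) ∑_{i < n} T^i f` of `f ∈ ℓ^p(ℤ; B)` for the shift `T`. -/
def lpErgodicAverage {B : Type*} [NormedAddCommGroup B] [NormedSpace ℝ B] {p : ℝ≥0∞}
    (n : ℕ) (f : lp (fun _ : ℤ => B) p) : lp (fun _ : ℤ => B) p :=
  (1 / n : ℝ) • ∑ i ∈ Finset.range n, ((lpShift B p) ^ i) f

end

/-! Convexity of power type `p` upgrades to a two-point inequality with a gain `c ‖x - y‖ ^ p`,
which passes to `ℓ^p(B)` by summing over `ℤ`. Let `e n` be the average of `f` over dyadic blocks of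
length `2 ^ n`, a reverse martingale starting at `e 0 = f`. Coarser averaging sends the midpoint of
`e n` and `e (n + k)` to `e (n + k)` and is a contraction, so the gain is controlled by the drop of
`‖e n‖ ^ p`; these drops telescope (`norm_blockAverage_rpow_add_le`).

It remains to compare `A t f` with `e n` when `2 ^ n ≤ t < 2 ^ (n + 1)`. Split `f` into the
differences `d m = e m - e (m + 1)` and a last term. For `m < n`, `d m` is a coboundary and `A t`
nearly kills it; for `m ≥ n` it is constant on long blocks and `A t` nearly fixes it. The error
decays geometrically in `|n - m|`, so Schur's test bounds its `ℓ^p` sum over the scales.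

Inside one scale, interpolating this decay with the Lipschitz bound for `t ↦ A t` gives increments
whose `p`-th powers are linear in `s - t`. A single potential dominates increments both within and
across scales, and its increments telescope along `t k`. -/

/-! ### Two-point inequality from uniform convexity. -/

/-- The parallelogram identity for squares, between superadditivity and convexity of `z ↦ z ^ (p /
2)`. -/
theorem scalar_clarkson {p a b : ℝ} (hp : 2 ≤ p) (hb : 0 ≤ b) (hab : b ≤ a) :
    ((a + b) / 2) ^ p + ((a - b) / 2) ^ p ≤ (a ^ p + b ^ p) / 2 := by
  have hq : 1 ≤ p / 2 := by linarith
  have ha : 0 ≤ a := hb.trans hab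
  have key : ∀ x : ℝ, 0 ≤ x → (x ^ 2) ^ (p / 2) = x ^ p := fun x hx ↦ by
    rw [← Real.rpow_natCast_mul hx]; congr 1; push_cast; ring
  have h1 := Real.add_rpow_le_rpow_add (sq_nonneg ((a + b) / 2)) (sq_nonneg ((a - b) / 2)) hq
  rw [key _ (by linarith), key _ (by linarith)] at h1
  have h2 := (convexOn_rpow hq).2 (Set.mem_Ici.2 (sq_nonneg a)) (Set.mem_Ici.2 (sq_nonneg b))
    (by norm_num : (0 : ℝ) ≤ 1 / 2) (by norm_num : (0 : ℝ) ≤ 1 / 2) (by norm_num)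
  simp only [smul_eq_mul] at h2
  rw [key _ ha, key _ hb] at h2
  have h3 : ((a + b) / 2) ^ 2 + ((a - b) / 2) ^ 2 = 1 / 2 * a ^ 2 + 1 / 2 * b ^ 2 := by ring
  rw [h3] at h1
  linarith

/-- The constant in the two-point inequality for a space whose modulus of convexity is `K ε ^ p`. -/
noncomputable def convexityConstant (p K : ℝ) : ℝ :=
  min ((1 / 8) ^ p) (1 / 2 * K * (3 / 4) ^ p * (1 / 2) ^ (p - 1))

theorem convexityConstant_pos {p K : ℝ} (hK : 0 < K) : 0 < convexityConstant p K := by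
  unfold convexityConstant
  positivity

section
variable {B : Type*} [NormedAddCommGroup B] [NormedSpace ℝ B]

theorem IsModulusOfUniformConvexity.norm_midpoint_le {p K : ℝ} (hp : 2 ≤ p)
    (hB : IsModulusOfUniformConvexity B (fun ε => K * ε ^ p)) {x y : B}
    (hx : ‖x‖ ≤ 1) (hy : ‖y‖ ≤ 1) : ‖(1 / 2 : ℝ) • (x + y)‖ ≤ 1 - K * ‖x - y‖ ^ p := by
  rcases (norm_nonneg (x - y)).eq_or_lt with h | h
  · rw [← h, Real.zero_rpow (by linarith), norm_smul]
    have := norm_add_le x y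
    norm_num
    linarith
  · exact (hB _ h ((norm_sub_le x y).trans (by linarith))).2.2 x y hx hy le_rfl

theorem two_point_of_norm_eq_one {p K : ℝ} (hp : 2 ≤ p) (hK : 0 < K)
    (hB : IsModulusOfUniformConvexity B (fun ε => K * ε ^ p)) {x y : B}
    (hx : ‖x‖ = 1) (hy : ‖y‖ ≤ 1) :
    ‖(1 / 2 : ℝ) • (x + y)‖ ^ p + convexityConstant p K * ‖x - y‖ ^ p
      ≤ (1 + ‖y‖ ^ p) / 2 := by
  set b := ‖y‖ with hb
  set s := ‖x - y‖ with hs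
  have hb0 : 0 ≤ b := norm_nonneg y
  have hs0 : 0 ≤ s := norm_nonneg _
  have hs2 : s ≤ 2 := (norm_sub_le x y).trans (by rw [hx]; linarith)
  have hp0 : 0 ≤ p := by linarith
  have hcl := scalar_clarkson hp hb0 hy
  rw [Real.one_rpow] at hcl
  have hsp : 0 ≤ s ^ p := by positivity
  -- If the norms differ by a fixed fraction of `s`, the scalar gain suffices. Otherwise the
  -- directions differ, and uniform convexity applies after normalising `y`.
  rcases le_or_gt (s / 4) (1 - b) with h | h
  · have h1 : ‖(1 / 2 : ℝ) • (x + y)‖ ≤ (1 + b) / 2 := by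
      rw [norm_smul]
      have := norm_add_le x y
      norm_num
      linarith
    have h2 : ‖(1 / 2 : ℝ) • (x + y)‖ ^ p ≤ ((1 + b) / 2) ^ p :=
      Real.rpow_le_rpow (norm_nonneg _) h1 hp0
    have h3 : (1 / 8 * s) ^ p ≤ ((1 - b) / 2) ^ p :=
      Real.rpow_le_rpow (by positivity) (by linarith) hp0
    rw [Real.mul_rpow (by norm_num) hs0] at h3
    have h4 : convexityConstant p K * s ^ p ≤ (1 / 8) ^ p * s ^ p :=
      mul_le_mul_of_nonneg_right (min_le_left _ _) hsp
    linarith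
  · have hbh : 1 / 2 ≤ b := by linarith
    have hbpos : 0 < b := by linarith
    have hy' : ‖b⁻¹ • y‖ = 1 := by
      rw [norm_smul, norm_inv, Real.norm_of_nonneg hb0, ← hb, inv_mul_cancel₀ hbpos.ne']
    have hyy : ‖b⁻¹ • y - y‖ = 1 - b := by
      have : b⁻¹ • y - y = (b⁻¹ - 1) • y := by rw [sub_smul, one_smul]
      rw [this, norm_smul, Real.norm_of_nonneg (by
        rw [sub_nonneg]; exact (one_le_inv₀ hbpos).2 hy), ← hb, sub_mul,
        inv_mul_cancel₀ hbpos.ne', one_mul]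
    -- Normalising moves `y` by `1 - b < s / 4`, which is the source of `3 / 4`.
    have hxy' : 3 / 4 * s ≤ ‖x - b⁻¹ • y‖ := by
      have : s ≤ ‖x - b⁻¹ • y‖ + ‖b⁻¹ • y - y‖ := by
        rw [hs]; exact norm_sub_le_norm_sub_add_norm_sub _ _ _
      linarith
    have h1 := hB.norm_midpoint_le hp hx.le hy'.le
    have h2 : (3 / 4 * s) ^ p ≤ ‖x - b⁻¹ • y‖ ^ p :=
      Real.rpow_le_rpow (by positivity) hxy' hp0
    rw [Real.mul_rpow (by norm_num) hs0] at h2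
    set v := (3 / 4 : ℝ) ^ p * s ^ p with hv
    have hv0 : 0 ≤ v := by positivity
    have h3 : ‖(1 / 2 : ℝ) • (x + y)‖ ≤ b * (1 - K * v) + (1 - b) / 2 := by
      have : (1 / 2 : ℝ) • (x + y)
          = b • ((1 / 2 : ℝ) • (x + b⁻¹ • y)) + ((1 - b) / 2) • x := by
        rw [smul_comm b, smul_add b, smul_smul b, mul_inv_cancel₀ hbpos.ne']
        module
      rw [this]
      refine (norm_add_le _ _).trans ?_
      rw [norm_smul b, norm_smul _ x, hx, Real.norm_of_nonneg hb0,
        Real.norm_of_nonneg (by linarith), mul_one]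
      have : K * v ≤ K * ‖x - b⁻¹ • y‖ ^ p := mul_le_mul_of_nonneg_left h2 hK.le
      gcongr
      linarith
    set μ := (1 + b) / 2 with hμ
    set u := 1 / 2 * K * v with hu
    have hu0 : 0 ≤ u := by positivity
    have hμ2 : 1 / 2 ≤ μ := by rw [hμ]; linarith
    have hμ0 : 0 < μ := by linarith
    have h4 : ‖(1 / 2 : ℝ) • (x + y)‖ ≤ μ - u := by
      have : 1 / 2 * (K * v) ≤ b * (K * v) := by gcongr
      rw [hμ, hu]
      linarith
    have h5 : 0 ≤ 1 - u / μ := by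
      rw [sub_nonneg, div_le_one hμ0]
      linarith [norm_nonneg ((1 / 2 : ℝ) • (x + y))]
    -- Since `1 - u / μ` lies in `[0, 1]`, its `p`-th power is at most itself; this keeps the gain
    -- linear in `u`.
    have h6 : ‖(1 / 2 : ℝ) • (x + y)‖ ^ p ≤ μ ^ p - u * μ ^ (p - 1) := by
      calc ‖(1 / 2 : ℝ) • (x + y)‖ ^ p ≤ (μ * (1 - u / μ)) ^ p := by
            refine Real.rpow_le_rpow (norm_nonneg _) (h4.trans_eq ?_) hp0
            field_simp
        _ = μ ^ p * (1 - u / μ) ^ p := Real.mul_rpow hμ0.le h5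
        _ ≤ μ ^ p * (1 - u / μ) := by
            gcongr
            conv_rhs => rw [← Real.rpow_one (1 - u / μ)]
            refine Real.rpow_le_rpow_of_exponent_ge' h5 ?_ zero_le_one (by linarith)
            have : 0 ≤ u / μ := by positivity
            linarith
        _ = μ ^ p - u * μ ^ (p - 1) := by
            rw [Real.rpow_sub_one hμ0.ne']; field_simp
    have h7 : u * (1 / 2) ^ (p - 1) ≤ u * μ ^ (p - 1) :=
      mul_le_mul_of_nonneg_left (Real.rpow_le_rpow (by norm_num) hμ2 (by linarith)) hu0
    have h8 : convexityConstant p K * s ^ p ≤ u * (1 / 2) ^ (p - 1) := by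
      calc _ ≤ (1 / 2 * K * (3 / 4) ^ p * (1 / 2) ^ (p - 1)) * s ^ p :=
            mul_le_mul_of_nonneg_right (min_le_right _ _) hsp
        _ = _ := by rw [hu, hv]; ring
    have h9 : 0 ≤ ((1 - b) / 2) ^ p := Real.rpow_nonneg (by linarith) _
    linarith

theorem two_point_of_norm_le {p K : ℝ} (hp : 2 ≤ p) (hK : 0 < K)
    (hB : IsModulusOfUniformConvexity B (fun ε => K * ε ^ p)) {x y : B} (hyx : ‖y‖ ≤ ‖x‖) :
    ‖(1 / 2 : ℝ) • (x + y)‖ ^ p + convexityConstant p K * ‖x - y‖ ^ p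
      ≤ (‖x‖ ^ p + ‖y‖ ^ p) / 2 := by
  rcases (norm_nonneg x).eq_or_lt with hx | hx
  · have hy : y = 0 := norm_le_zero_iff.1 (hx ▸ hyx)
    have hx : x = 0 := norm_eq_zero.1 hx.symm
    simp [hx, hy, Real.zero_rpow (show p ≠ 0 by linarith)]
  · have hn : ∀ z : B, ‖z‖ = ‖x‖ * ‖‖x‖⁻¹ • z‖ := fun z ↦ by
      rw [norm_smul, norm_inv, norm_norm, mul_inv_cancel_left₀ hx.ne']
    have hx1 : ‖‖x‖⁻¹ • x‖ = 1 := by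
      rw [norm_smul, norm_inv, norm_norm, inv_mul_cancel₀ hx.ne']
    have hy1 : ‖‖x‖⁻¹ • y‖ ≤ 1 := by
      rw [norm_smul, norm_inv, norm_norm, inv_mul_le_iff₀ hx, mul_one]
      exact hyx
    have h := two_point_of_norm_eq_one hp hK hB hx1 hy1
    rw [← smul_add, ← smul_sub, smul_comm] at h
    have h' := mul_le_mul_of_nonneg_left h (Real.rpow_nonneg hx.le p)
    rw [mul_add, mul_left_comm, ← Real.mul_rpow hx.le (norm_nonneg _),
      ← Real.mul_rpow hx.le (norm_nonneg _), ← hn, ← hn, mul_div_assoc', mul_add, mul_one,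
      ← Real.mul_rpow hx.le (norm_nonneg _), ← hn] at h'
    exact h'

theorem two_point_inequality {p K : ℝ} (hp : 2 ≤ p) (hK : 0 < K)
    (hB : IsModulusOfUniformConvexity B (fun ε => K * ε ^ p)) (x y : B) :
    ‖(1 / 2 : ℝ) • (x + y)‖ ^ p + convexityConstant p K * ‖x - y‖ ^ p
      ≤ (‖x‖ ^ p + ‖y‖ ^ p) / 2 := by
  rcases le_total ‖y‖ ‖x‖ with h | h
  · exact two_point_of_norm_le hp hK hB h
  · rw [add_comm x, norm_sub_rev, add_comm (‖x‖ ^ p)]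
    exact two_point_of_norm_le hp hK hB h

end

theorem lp_hasSum_rpow {B ι : Type*} [NormedAddCommGroup B] {p : ℝ} (hp : 0 < p) (f : lp (fun _ : ι => B) (ENNReal.ofReal p)) :
    HasSum (fun x => ‖f x‖ ^ p) (‖f‖ ^ p) := by
  have := lp.hasSum_norm (by rw [ENNReal.toReal_ofReal hp.le]; exact hp) f
  rwa [ENNReal.toReal_ofReal hp.le] at this

theorem lp_two_point_inequality {B ι : Type*} [NormedAddCommGroup B] [NormedSpace ℝ B] {p K : ℝ}
    (hp : 2 ≤ p) (hK : 0 < K)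
    (hB : IsModulusOfUniformConvexity B (fun ε => K * ε ^ p))
    (f g : lp (fun _ : ι => B) (ENNReal.ofReal p)) :
    ‖(1 / 2 : ℝ) • (f + g)‖ ^ p + convexityConstant p K * ‖f - g‖ ^ p
      ≤ (‖f‖ ^ p + ‖g‖ ^ p) / 2 := by
  have hp0 : 0 < p := by linarith
  have h1 : HasSum (fun x => ‖(1 / 2 : ℝ) • (f x + g x)‖ ^ p) (‖(1 / 2 : ℝ) • (f + g)‖ ^ p) :=
    lp_hasSum_rpow hp0 ((1 / 2 : ℝ) • (f + g))
  have h2 : HasSum (fun x => ‖f x - g x‖ ^ p) (‖f - g‖ ^ p) := lp_hasSum_rpow hp0 (f - g)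
  have h3 := h1.add (h2.mul_left (convexityConstant p K))
  have h4 := ((lp_hasSum_rpow hp0 f).add (lp_hasSum_rpow hp0 g)).div_const 2
  exact hasSum_le (fun x ↦ two_point_inequality hp hK hB (f x) (g x)) h3 h4

/-! ### Summation over blocks of `ℤ`. -/

theorem hasSum_block_sum (N : ℕ) [NeZero N] {h : ℤ → ℝ} {s : ℝ} (hs : HasSum h s) :
    HasSum (fun q : ℤ => ∑ i ∈ Finset.range N, h (N * q + i)) s := by
  have h1 := ((Int.divModEquiv N).symm.hasSum_iff.2 hs).prod_fiberwise (fun q ↦ hasSum_fintype _)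
  convert h1 using 2 with q
  rw [Finset.sum_range]
  exact Finset.sum_congr rfl fun i _ ↦ by
    simp [Int.divModEquiv_symm_apply, mul_comm]

/-- Under division with remainder, `ℤ ≃ ℤ × Fin N`, the sum factors. Weight `1` serves block
averages; an indicator weight counts the positions whose shift crosses a block boundary. -/
theorem hasSum_block_mul (N : ℕ) [NeZero N] {D : ℤ → ℝ} {s : ℝ} (hD : 0 ≤ D) (hs : HasSum D s)
    {w : ℕ → ℝ} (hw : 0 ≤ w) :
    HasSum (fun x : ℤ => D (x / N) * w (x % N).toNat) (s * ∑ j ∈ Finset.range N, w j) := by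
  rw [Finset.sum_range]
  have hf : HasSum (fun i : Fin N => w i) (∑ i : Fin N, w i) := hasSum_fintype _
  have h1 := hs.mul hf (hs.summable.mul_of_nonneg hf.summable hD fun _ ↦ hw _)
  convert (Int.divModEquiv N).hasSum_iff.2 h1 using 1
  · rfl
  funext x
  have hN : (0 : ℤ) < N := by exact_mod_cast NeZero.pos N
  have h2 : (x % N).toNat < N := by
    have := Int.emod_nonneg x hN.ne'
    have := Int.emod_lt_of_pos x hN
    omega
  simp [Int.natMod, Nat.mod_eq_of_lt h2]

theorem block_ediv {N : ℕ} (q : ℤ) {j : ℕ} (hj : j < N) : ((N : ℤ) * q + j) / N = q := by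
  have hN : (0 : ℤ) < N := by exact_mod_cast (Nat.zero_le j).trans_lt hj
  rw [Int.add_comm, Int.add_mul_ediv_left _ _ hN.ne',
    Int.ediv_eq_zero_of_lt (by positivity) (by exact_mod_cast hj), zero_add]

theorem block_emod {N : ℕ} (q : ℤ) {j : ℕ} (hj : j < N) : ((N : ℤ) * q + j) % N = j := by
  rw [Int.add_comm, Int.add_mul_emod_self_left]
  exact Int.emod_eq_of_lt (by positivity) (by exact_mod_cast hj)

theorem exists_block (N : ℕ) [NeZero N] (x : ℤ) : ∃ q : ℤ, ∃ j < N, x = (N : ℤ) * q + (j : ℕ) := by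
  have hN : (0 : ℤ) < N := by exact_mod_cast NeZero.pos N
  have h1 := Int.emod_nonneg x hN.ne'
  have h2 := Int.emod_lt_of_pos x hN
  have h3 := Int.mul_ediv_add_emod x N
  exact ⟨x / N, (x % N).toNat, by omega, by omega⟩

section
variable {B : Type*} [NormedAddCommGroup B] {p : ℝ}

theorem exists_lp_of_rpow_le {ι : Type*} (hp : 0 < p) {g : ι → B} {φ : ι → ℝ} {s A : ℝ}
    (hA : 0 ≤ A) (hg : ∀ x, ‖g x‖ ^ p ≤ φ x) (hφ : HasSum φ s) (hs : s ≤ A ^ p) :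
    ∃ g' : lp (fun _ : ι => B) (ENNReal.ofReal p), (∀ x, g' x = g x) ∧ ‖g'‖ ≤ A := by
  have hP : (ENNReal.ofReal p).toReal = p := ENNReal.toReal_ofReal hp.le
  have hmem : Memℓp g (ENNReal.ofReal p) := by
    refine memℓp_gen ?_
    rw [hP]
    exact hφ.summable.of_nonneg_of_le (fun x ↦ by positivity) hg
  refine ⟨⟨g, hmem⟩, fun _ ↦ rfl, ?_⟩
  have h1 := lp_hasSum_rpow hp (⟨g, hmem⟩ : lp (fun _ : ι => B) (ENNReal.ofReal p))
  have h2 := (hasSum_le hg h1 hφ).trans hs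
  exact (Real.rpow_le_rpow_iff (lp.norm_nonneg' _) hA hp).1 h2

theorem average_rpow_le (hp : 1 ≤ p) {N : ℕ} (hN : 0 < N) {u : ℕ → ℝ} (hu : ∀ i, 0 ≤ u i) :
    ((N : ℝ)⁻¹ * ∑ i ∈ Finset.range N, u i) ^ p ≤ (N : ℝ)⁻¹ * ∑ i ∈ Finset.range N, u i ^ p := by
  have hN' : (N : ℝ) ≠ 0 := by positivity
  rw [Finset.mul_sum, Finset.mul_sum]
  refine Real.rpow_arith_mean_le_arith_mean_rpow _ _ _ (fun _ _ ↦ by positivity) ?_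
    (fun i _ ↦ hu i) hp
  simp [hN']

/-- Jensen on each block. It is used with `A = 1` for block averages and with `A` the block length
for primitives. -/
theorem exists_lp_of_norm_le_blockAverage (hp : 1 ≤ p) (N : ℕ) [NeZero N]
    (f : lp (fun _ : ℤ => B) (ENNReal.ofReal p)) {g : ℤ → B} {A : ℝ} (hA : 0 ≤ A)
    (hg : ∀ x, ‖g x‖ ≤ A * ((N : ℝ)⁻¹ * ∑ i ∈ Finset.range N, ‖f (N * (x / N) + i)‖)) :
    ∃ g' : lp (fun _ : ℤ => B) (ENNReal.ofReal p), (∀ x, g' x = g x) ∧ ‖g'‖ ≤ A * ‖f‖ := by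
  have hp0 : 0 < p := by linarith
  have hN : 0 < N := NeZero.pos N
  have hN' : (N : ℝ) ≠ 0 := by positivity
  have h1 := (hasSum_block_sum N (lp_hasSum_rpow hp0 f)).mul_left (N : ℝ)⁻¹
  have h2 := (hasSum_block_mul N (fun q ↦ by positivity) h1 (w := fun _ ↦ 1)
    (fun _ ↦ zero_le_one)).mul_left (A ^ p)
  refine exists_lp_of_rpow_le hp0 (mul_nonneg hA (lp.norm_nonneg' f)) (fun x ↦ ?_) h2 ?_
  · refine (Real.rpow_le_rpow (norm_nonneg _) (hg x) hp0.le).trans ?_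
    rw [Real.mul_rpow hA (by positivity), mul_one]
    gcongr
    exact average_rpow_le hp hN fun _ ↦ norm_nonneg _
  · rw [Real.mul_rpow hA (lp.norm_nonneg' f)]
    refine le_of_eq ?_
    simp only [Finset.sum_const, Finset.card_range, nsmul_eq_mul, mul_one]
    field_simp

end

/-! ### Ergodic averages against block averages. -/

section
variable {B : Type*} [NormedAddCommGroup B] [NormedSpace ℝ B] {p : ℝ}

theorem lpShift_pow_apply {P : ℝ≥0∞} (i : ℕ) (f : lp (fun _ : ℤ => B) P) (x : ℤ) :
    ((lpShift B P ^ i) f) x = f (x + i) := by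
  induction i generalizing x with
  | zero => simp
  | succ i ih =>
    rw [pow_succ', Module.End.mul_apply]
    change ((lpShift B P ^ i) f) (x + 1) = _
    rw [ih, show x + 1 + (i : ℤ) = x + ((i + 1 : ℕ) : ℤ) by push_cast; ring]

theorem norm_lpShift_pow (hp : 0 < p) (i : ℕ) (f : lp (fun _ : ℤ => B) (ENNReal.ofReal p)) :
    ‖(lpShift B (ENNReal.ofReal p) ^ i) f‖ = ‖f‖ := by
  have h1 := lp_hasSum_rpow hp ((lpShift B (ENNReal.ofReal p) ^ i) f)
  have h2 := (Equiv.addRight (i : ℤ)).hasSum_iff.2 (lp_hasSum_rpow hp f)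
  simp only [lpShift_pow_apply] at h1
  have h3 := h1.unique h2
  exact (Real.rpow_left_inj (lp.norm_nonneg' _) (lp.norm_nonneg' _) hp.ne').1 h3

theorem norm_lpErgodicAverage_le [Fact (1 ≤ ENNReal.ofReal p)] (hp : 0 < p) (t : ℕ)
    (f : lp (fun _ : ℤ => B) (ENNReal.ofReal p)) : ‖lpErgodicAverage t f‖ ≤ ‖f‖ := by
  rcases t.eq_zero_or_pos with rfl | ht
  · simp [lpErgodicAverage]
  · unfold lpErgodicAverage
    rw [norm_smul, Real.norm_of_nonneg (by positivity)]
    have : ‖∑ i ∈ Finset.range t, (lpShift B (ENNReal.ofReal p) ^ i) f‖ ≤ t * ‖f‖ := by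
      refine (norm_sum_le _ _).trans ?_
      simp [norm_lpShift_pow hp]
    calc _ ≤ (1 / t : ℝ) * (t * ‖f‖) := by gcongr
      _ = ‖f‖ := by field_simp

/-- `A s f` is the convex combination of `A t f` and the mean over `t ≤ i < s`, the latter with
weight `(s - t) / s`. -/
theorem norm_lpErgodicAverage_sub_le [Fact (1 ≤ ENNReal.ofReal p)] (hp : 0 < p) {t s : ℕ}
    (ht : 0 < t) (hts : t ≤ s) (f : lp (fun _ : ℤ => B) (ENNReal.ofReal p)) :
    ‖lpErgodicAverage s f - lpErgodicAverage t f‖ ≤ 2 * ((s - t) / s) * ‖f‖ := by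
  set T := lpShift B (ENNReal.ofReal p) with hT
  have hs : 0 < s := ht.trans_le hts
  have hs' : (0 : ℝ) < s := by exact_mod_cast hs
  have ht' : (0 : ℝ) < t := by exact_mod_cast ht
  have hts' : (t : ℝ) ≤ s := by exact_mod_cast hts
  have h1 : lpErgodicAverage s f - lpErgodicAverage t f
      = (1 / s : ℝ) • ∑ i ∈ Finset.Ico t s, (T ^ i) f
        - ((s - t) / s : ℝ) • lpErgodicAverage t f := by
    unfold lpErgodicAverage
    rw [← Finset.sum_range_add_sum_Ico _ hts, ← hT, smul_smul, smul_add]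
    have : (1 / s : ℝ) = 1 / t - (s - t) / s * (1 / t) := by field_simp; ring
    nth_rewrite 1 [this]
    rw [sub_smul]
    abel
  have h2 : ‖∑ i ∈ Finset.Ico t s, (T ^ i) f‖ ≤ (s - t) * ‖f‖ := by
    refine (norm_sum_le _ _).trans ?_
    simp [hT, norm_lpShift_pow hp, Nat.cast_sub hts]
  rw [h1]
  refine (norm_sub_le _ _).trans ?_
  rw [norm_smul, norm_smul, Real.norm_of_nonneg (by positivity), Real.norm_of_nonneg
    (div_nonneg (by linarith) hs'.le)]
  have h3 := norm_lpErgodicAverage_le hp t f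
  have h4 : 0 ≤ ((s : ℝ) - t) / s := div_nonneg (by linarith) hs'.le
  calc _ ≤ 1 / (s : ℝ) * ((s - t) * ‖f‖) + (s - t) / s * ‖f‖ := by gcongr
    _ = _ := by ring

theorem lpErgodicAverage_add {P : ℝ≥0∞} (t : ℕ) (f g : lp (fun _ : ℤ => B) P) :
    lpErgodicAverage t (f + g) = lpErgodicAverage t f + lpErgodicAverage t g := by
  simp [lpErgodicAverage, Finset.sum_add_distrib]

/-- Partial sums from the start of each block give `G` with `d = T G - G` and `‖G‖ ≤ L ‖d‖`, so the
sum in `A t d` telescopes to two terms. -/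
theorem norm_lpErgodicAverage_le_of_block_sum_eq_zero [Fact (1 ≤ ENNReal.ofReal p)] (hp : 1 ≤ p)
    (L : ℕ) [NeZero L] {t : ℕ} (ht : 0 < t) (d : lp (fun _ : ℤ => B) (ENNReal.ofReal p))
    (hd : ∀ q : ℤ, ∑ i ∈ Finset.range L, d (L * q + i) = 0) :
    ‖lpErgodicAverage t d‖ ≤ 2 * (L / t) * ‖d‖ := by
  have hp0 : 0 < p := by linarith
  have hL : 0 < L := NeZero.pos L
  have hLZ : (0 : ℤ) < L := by exact_mod_cast hL
  have hL' : (L : ℝ) ≠ 0 := by positivity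
  obtain ⟨G, hG, hGn⟩ := exists_lp_of_norm_le_blockAverage hp L d
    (g := fun x ↦ ∑ i ∈ Finset.range (x % L).toNat, d (L * (x / L) + i)) (A := L)
    (by positivity) (fun x ↦ by
      rw [mul_inv_cancel_left₀ hL']
      refine (norm_sum_le _ _).trans
        (Finset.sum_le_sum_of_subset_of_nonneg ?_ fun _ _ _ ↦ norm_nonneg _)
      have := Int.emod_lt_of_pos x hLZ
      exact Finset.range_subset_range.2 (by omega))
  set T := lpShift B (ENNReal.ofReal p) with hT
  have hGd : d = T G - G := by
    ext x
    change d x = G (x + 1) - G x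
    obtain ⟨q, j, hj, rfl⟩ := exists_block L x
    rw [hG, hG, block_ediv q hj, block_emod q hj, Int.toNat_natCast]
    rcases (Nat.succ_le_of_lt hj).lt_or_eq with h | h
    · have h1 : (L : ℤ) * q + j + 1 = L * q + ((j + 1 : ℕ) : ℤ) := by push_cast; ring
      rw [h1, block_ediv q h, block_emod q h, Int.toNat_natCast, Finset.sum_range_succ]
      simp
    -- At the last point of a block `G` restarts from `0`; the identity survives because the block
    -- sum vanishes.
    · have h1 : (L : ℤ) * q + j + 1 = L * (q + 1) + ((0 : ℕ) : ℤ) := by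
        have : (L : ℤ) = j + 1 := by rw [← h]; push_cast; ring
        push_cast
        linarith
      have h2 := hd q
      rw [← h, Finset.sum_range_succ, h] at h2
      rw [h1, block_ediv _ hL, block_emod _ hL, Int.toNat_natCast, Finset.sum_range_zero, zero_sub]
      exact eq_neg_of_add_eq_zero_right h2
  have hA : lpErgodicAverage t d = (1 / t : ℝ) • ((T ^ t) G - G) := by
    have := Finset.sum_range_sub (fun i ↦ (T ^ i) G) t
    rw [pow_zero, Module.End.one_apply] at this
    rw [← this]
    unfold lpErgodicAverage
    congr 1
    refine Finset.sum_congr rfl fun i _ ↦ ?_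
    conv_lhs => rw [hGd]
    rw [map_sub, pow_succ, Module.End.mul_apply]
  rw [hA, norm_smul, Real.norm_of_nonneg (by positivity)]
  have h3 : ‖(T ^ t) G - G‖ ≤ 2 * (L * ‖d‖) := by
    refine (norm_sub_le _ _).trans ?_
    rw [hT, norm_lpShift_pow hp0]
    linarith
  calc _ ≤ 1 / (t : ℝ) * (2 * (L * ‖d‖)) := by gcongr
    _ = _ := by ring

/-- A shift by `i ≤ M` changes the value only at the `i` positions of each block that cross into the
next one, and each sees the same jump. Hence the exponent `p⁻¹` in the bounds below. -/
theorem rpow_norm_shift_sub_of_block_const (hp : 0 < p)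
    (M : ℕ) [NeZero M] {i : ℕ} (hi : i ≤ M) (d : lp (fun _ : ℤ => B) (ENNReal.ofReal p))
    (hd : ∀ x, d x = d (M * (x / M))) :
    ‖(lpShift B (ENNReal.ofReal p) ^ i) d - d‖ ^ p
      = i / M * ‖(lpShift B (ENNReal.ofReal p) ^ M) d - d‖ ^ p := by
  have hM : 0 < M := NeZero.pos M
  have hM' : (M : ℝ) ≠ 0 := by positivity
  have hS : ∀ j : ℕ, HasSum (fun x ↦ ‖d (x + j) - d x‖ ^ p)
      (‖(lpShift B (ENNReal.ofReal p) ^ j) d - d‖ ^ p) := fun j ↦ by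
    have := lp_hasSum_rpow hp ((lpShift B (ENNReal.ofReal p) ^ j) d - d)
    simpa only [lp.coeFn_sub, Pi.sub_apply, lpShift_pow_apply] using this
  have hc : ∀ (q : ℤ) (j : ℕ), j < M → d (M * q + j) = d (M * q) := fun q j hj ↦ by
    rw [hd, block_ediv q hj]
  have h1 : HasSum (fun q : ℤ ↦ ‖d (M * (q + 1)) - d (M * q)‖ ^ p)
      ((M : ℝ)⁻¹ * ‖(lpShift B (ENNReal.ofReal p) ^ M) d - d‖ ^ p) := by
    convert (hasSum_block_sum M (hS M)).mul_left (M : ℝ)⁻¹ using 1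
    · rfl
    funext q
    rw [Finset.sum_congr rfl (g := fun _ ↦ ‖d (M * (q + 1)) - d (M * q)‖ ^ p)]
    · simp [hM']
    · intro j hj
      rw [Finset.mem_range] at hj
      rw [show (M : ℤ) * q + j + M = M * (q + 1) + j by ring, hc _ _ hj, hc _ _ hj]
  have h2 := hasSum_block_mul M (fun q ↦ by positivity) h1
    (w := fun j ↦ if M ≤ j + i then 1 else 0) (fun j ↦ by dsimp; split_ifs <;> simp)
  have h3 : ∑ j ∈ Finset.range M, (if M ≤ j + i then (1 : ℝ) else 0) = i := by
    rw [← Finset.sum_filter, Finset.sum_const, nsmul_one]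
    congr 1
    have : Finset.filter (fun j ↦ M ≤ j + i) (Finset.range M) = Finset.Ico (M - i) M := by
      ext j
      simp only [Finset.mem_filter, Finset.mem_range, Finset.mem_Ico]
      omega
    rw [this, Nat.card_Ico]
    omega
  rw [h3] at h2
  have h4 : (fun x : ℤ ↦ ‖d (x + i) - d x‖ ^ p) = fun x : ℤ ↦
      ‖d (M * (x / M + 1)) - d (M * (x / M))‖ ^ p
        * if M ≤ (x % M).toNat + i then (1 : ℝ) else 0 := by
    funext x
    obtain ⟨q, j, hj, rfl⟩ := exists_block M x
    rw [block_ediv q hj, block_emod q hj, Int.toNat_natCast, hc q j hj]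
    split_ifs with h
    · rw [mul_one, show (M : ℤ) * q + j + i = M * (q + 1) + ((j + i - M : ℕ) : ℤ) by
        push_cast [Nat.cast_sub h]; ring, hc _ _ (by omega)]
    · rw [show (M : ℤ) * q + j + i = M * q + ((j + i : ℕ) : ℤ) by push_cast; ring,
        hc _ _ (by omega), sub_self, norm_zero, Real.zero_rpow hp.ne', mul_zero]
  rw [← h4] at h2
  rw [(hS i).unique h2]
  ring

theorem norm_lpErgodicAverage_sub_self_le_of_block_const [Fact (1 ≤ ENNReal.ofReal p)]
    (hp : 0 < p) (M : ℕ) [NeZero M] {t : ℕ} (ht : 0 < t) (htM : t ≤ M)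
    (d : lp (fun _ : ℤ => B) (ENNReal.ofReal p)) (hd : ∀ x, d x = d (M * (x / M))) :
    ‖lpErgodicAverage t d - d‖ ≤ 2 * (t / M : ℝ) ^ p⁻¹ * ‖d‖ := by
  have hM : 0 < M := NeZero.pos M
  have h1 : ∀ i < t, ‖(lpShift B (ENNReal.ofReal p) ^ i) d - d‖
      ≤ 2 * (t / M : ℝ) ^ p⁻¹ * ‖d‖ := fun i hi ↦ by
    rw [← Real.rpow_le_rpow_iff (norm_nonneg _) (by positivity) hp,
      rpow_norm_shift_sub_of_block_const hp M (by omega) d hd,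
      show 2 * (t / M : ℝ) ^ p⁻¹ * ‖d‖ = (t / M : ℝ) ^ p⁻¹ * (2 * ‖d‖) by ring,
      Real.mul_rpow (by positivity) (by positivity), Real.rpow_inv_rpow (by positivity) hp.ne']
    have : ‖(lpShift B (ENNReal.ofReal p) ^ M) d - d‖ ≤ 2 * ‖d‖ := by
      refine (norm_sub_le _ _).trans ?_
      rw [norm_lpShift_pow hp]
      linarith
    have : (i : ℝ) ≤ t := by exact_mod_cast hi.le
    gcongr
  have h2 : lpErgodicAverage t d - d
      = (1 / t : ℝ) • ∑ i ∈ Finset.range t, ((lpShift B (ENNReal.ofReal p) ^ i) d - d) := by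
    unfold lpErgodicAverage
    rw [Finset.sum_sub_distrib, smul_sub, Finset.sum_const, Finset.card_range,
      ← Nat.cast_smul_eq_nsmul ℝ, smul_smul, one_div_mul_cancel (by positivity), one_smul]
  rw [h2, norm_smul, Real.norm_of_nonneg (by positivity)]
  have h3 := norm_sum_le_of_le (Finset.range t) (fun i hi ↦ h1 i (Finset.mem_range.1 hi))
  rw [Finset.sum_const, Finset.card_range, nsmul_eq_mul] at h3
  calc _ ≤ 1 / (t : ℝ) * (t * (2 * (t / M : ℝ) ^ p⁻¹ * ‖d‖)) := by gcongr
    _ = _ := by field_simp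

theorem sum_range_mul_eq {A : Type*} [AddCommMonoid A] (M k : ℕ) (g : ℕ → A) :
    ∑ i ∈ Finset.range (M * k), g i
      = ∑ a ∈ Finset.range k, ∑ b ∈ Finset.range M, g (M * a + b) := by
  induction k with
  | zero => simp
  | succ k ih => rw [Nat.mul_succ, Finset.sum_range_add, ih, Finset.sum_range_succ]

/-- A block of length `M * k` is a union of `k` blocks of length `M`, on each of which averaging
preserves the sum. -/
theorem sum_block_blockAverage {M : ℕ} (hM : 0 < M) {f e : ℤ → B}
    (he : ∀ x : ℤ, e x = (M : ℝ)⁻¹ • ∑ i ∈ Finset.range M, f (M * (x / M) + i)) (k : ℕ) (q : ℤ) :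
    ∑ i ∈ Finset.range (M * k), e ((M * k : ℕ) * q + i)
      = ∑ i ∈ Finset.range (M * k), f ((M * k : ℕ) * q + i) := by
  have hM' : (M : ℝ) ≠ 0 := by positivity
  rw [sum_range_mul_eq, sum_range_mul_eq]
  refine Finset.sum_congr rfl fun a _ ↦ ?_
  have h1 : ∀ b : ℕ, (((M * k : ℕ) : ℤ) * q + ((M * a + b : ℕ) : ℤ)) = M * (k * q + a) + b :=
    fun b ↦ by push_cast; ring
  simp only [h1]
  rw [Finset.sum_congr rfl (g := fun _ ↦ e (M * (k * q + a)))]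
  · have := block_ediv (k * q + a) hM
    rw [Nat.cast_zero, add_zero] at this
    rw [he, this, Finset.sum_const, Finset.card_range, ← Nat.cast_smul_eq_nsmul ℝ, smul_smul,
      mul_inv_cancel₀ hM', one_smul]
  · intro b hb
    have := block_ediv (k * q + a) hM
    rw [Nat.cast_zero, add_zero] at this
    rw [he, he, block_ediv _ (Finset.mem_range.1 hb), this]

theorem exists_blockAverage (hp : 1 ≤ p) (N : ℕ) [NeZero N]
    (f : lp (fun _ : ℤ => B) (ENNReal.ofReal p)) :
    ∃ e : lp (fun _ : ℤ => B) (ENNReal.ofReal p),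
      (∀ x : ℤ, e x = (N : ℝ)⁻¹ • ∑ i ∈ Finset.range N, f (N * (x / N) + i)) ∧ ‖e‖ ≤ ‖f‖ := by
  have := exists_lp_of_norm_le_blockAverage hp N f
    (g := fun x ↦ (N : ℝ)⁻¹ • ∑ i ∈ Finset.range N, f (N * (x / N) + i)) zero_le_one (fun x ↦ by
      rw [one_mul, norm_smul, Real.norm_of_nonneg (by positivity)]
      gcongr
      exact norm_sum_le _ _)
  rwa [one_mul] at this

/-- Averaging over the coarse blocks maps both `e` and `e'` to `e'`, so `‖e'‖` is at most the norm
of their midpoint; the two-point inequality then gives the drop. -/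
theorem norm_blockAverage_rpow_add_le [Fact (1 ≤ ENNReal.ofReal p)] {K : ℝ} (hp : 2 ≤ p)
    (hK : 0 < K) (hB : IsModulusOfUniformConvexity B (fun ε => K * ε ^ p)) (M k : ℕ) [NeZero M]
    [NeZero (M * k)] (f e e' : lp (fun _ : ℤ => B) (ENNReal.ofReal p))
    (he : ∀ x : ℤ, e x = (M : ℝ)⁻¹ • ∑ i ∈ Finset.range M, f (M * (x / M) + i))
    (he' : ∀ x : ℤ, e' x = ((M * k : ℕ) : ℝ)⁻¹ •
      ∑ i ∈ Finset.range (M * k), f ((M * k : ℕ) * (x / (M * k : ℕ)) + i)) :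
    ‖e'‖ ^ p + 2 * convexityConstant p K * ‖e - e'‖ ^ p ≤ ‖e‖ ^ p := by
  have hM : 0 < M := NeZero.pos M
  have hMk : 0 < M * k := NeZero.pos _
  obtain ⟨g, hg, hgn⟩ := exists_blockAverage (by linarith) (M * k) ((1 / 2 : ℝ) • (e + e'))
  have hge : g = e' := by
    ext x
    rw [hg, he']
    congr 1
    have h1 := sum_block_blockAverage hM he k (x / (M * k : ℕ))
    -- The factor `1` expresses that coarse averaging preserves the block sums of `e'`.
    have h2 := sum_block_blockAverage hMk he' 1 (x / (M * k : ℕ))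
    rw [mul_one] at h2
    simp only [lp.coeFn_smul, lp.coeFn_add, Pi.smul_apply, Pi.add_apply]
    rw [← Finset.smul_sum, Finset.sum_add_distrib, h1, h2]
    module
  rw [hge] at hgn
  have h1 := lp_two_point_inequality hp hK hB e e'
  have h2 := Real.rpow_le_rpow (norm_nonneg _) hgn (by linarith : 0 ≤ p)
  linarith

end

/-! ### Geometric kernels and Schur's test. -/

/-- With truncated subtraction the exponent is `|n - m|`; the two sides of `n` give two geometric
series. -/
theorem sum_pow_abs_sub_le {ρ : ℝ} (h0 : 0 ≤ ρ) (h1 : ρ < 1) (n M : ℕ) :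
    ∑ m ∈ Finset.range M, ρ ^ ((n - m) + (m - n)) ≤ 2 / (1 - ρ) := by
  have hgeom : ∀ N, ∑ j ∈ Finset.range N, ρ ^ j ≤ (1 - ρ)⁻¹ := fun N ↦ by
    rw [← tsum_geometric_of_lt_one h0 h1]
    exact (summable_geometric_of_lt_one h0 h1).sum_le_tsum _ fun _ _ ↦ by positivity
  calc ∑ m ∈ Finset.range M, ρ ^ ((n - m) + (m - n))
      ≤ ∑ m ∈ Finset.range ((n + 1) + M), ρ ^ ((n - m) + (m - n)) :=
        Finset.sum_le_sum_of_subset_of_nonneg (Finset.range_subset_range.2 (by omega))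
          fun _ _ _ ↦ by positivity
    _ = ∑ m ∈ Finset.range (n + 1), ρ ^ (n + 1 - 1 - m) + ∑ j ∈ Finset.range M, ρ ^ (j + 1) := by
        rw [Finset.sum_range_add]
        congr 1
        · refine Finset.sum_congr rfl fun m hm ↦ ?_
          rw [Finset.mem_range] at hm
          congr 1
          omega
        · refine Finset.sum_congr rfl fun m _ ↦ ?_
          congr 1
          omega
    _ ≤ (1 - ρ)⁻¹ + (1 - ρ)⁻¹ := by
        rw [Finset.sum_range_reflect (fun j ↦ ρ ^ j)]
        refine add_le_add (hgeom _) (le_trans ?_ (hgeom M))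
        exact Finset.sum_le_sum fun j _ ↦ pow_le_pow_of_le_one h0 h1.le (Nat.le_succ j)
    _ = 2 / (1 - ρ) := by ring

/-- **Schur's test** for a symmetric nonnegative kernel. -/
theorem schur_test {p S : ℝ} (hp : 1 ≤ p) {w : ℕ → ℕ → ℝ} (hw : ∀ n m, 0 ≤ w n m)
    (hsymm : ∀ n m, w n m = w m n) (s : Finset ℕ) (hS : ∀ n, ∑ m ∈ s, w n m ≤ S)
    {δ : ℕ → ℝ} (hδ : ∀ m, 0 ≤ δ m) :
    ∑ n ∈ s, (∑ m ∈ s, w n m * δ m) ^ p ≤ S ^ p * ∑ m ∈ s, δ m ^ p := by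
  have hp0 : 0 < p := by linarith
  have hS0 : 0 ≤ S := (Finset.sum_nonneg fun m _ ↦ hw 0 m).trans (hS 0)
  -- Weighted Hölder on each row; after exchanging the sums, symmetry turns column sums into row
  -- sums.
  have h1 : ∀ n, (∑ m ∈ s, w n m * δ m) ^ p ≤ S ^ (p - 1) * ∑ m ∈ s, w n m * δ m ^ p := fun n ↦ by
    have hW : 0 ≤ ∑ m ∈ s, w n m := Finset.sum_nonneg fun m _ ↦ hw n m
    have hD : 0 ≤ ∑ m ∈ s, w n m * δ m ^ p :=
      Finset.sum_nonneg fun m _ ↦ mul_nonneg (hw n m) (Real.rpow_nonneg (hδ m) p)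
    have h2 := Real.inner_le_weight_mul_Lp_of_nonneg s hp (w n) δ (hw n) hδ
    have h3 := Real.rpow_le_rpow (Finset.sum_nonneg fun m _ ↦ mul_nonneg (hw n m) (hδ m)) h2 hp0.le
    rw [Real.mul_rpow (by positivity) (by positivity), Real.rpow_inv_rpow hD hp0.ne',
      ← Real.rpow_mul hW, sub_mul, one_mul, inv_mul_cancel₀ hp0.ne'] at h3
    refine h3.trans (mul_le_mul_of_nonneg_right ?_ hD)
    exact Real.rpow_le_rpow hW (hS n) (by linarith)
  calc ∑ n ∈ s, (∑ m ∈ s, w n m * δ m) ^ p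
      ≤ ∑ n ∈ s, S ^ (p - 1) * ∑ m ∈ s, w n m * δ m ^ p := Finset.sum_le_sum fun n _ ↦ h1 n
    _ = S ^ (p - 1) * ∑ m ∈ s, (∑ n ∈ s, w m n) * δ m ^ p := by
        rw [← Finset.mul_sum, Finset.sum_comm]
        simp only [Finset.sum_mul]
        congr 1
        exact Finset.sum_congr rfl fun m _ ↦ Finset.sum_congr rfl fun n _ ↦ by rw [hsymm]
    _ ≤ S ^ (p - 1) * ∑ m ∈ s, S * δ m ^ p := by
        gcongr with m _
        · exact Real.rpow_nonneg (hδ m) p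
        · exact hS m
    _ = S ^ p * ∑ m ∈ s, δ m ^ p := by
        rw [← Finset.mul_sum, ← mul_assoc]
        congr 1
        rcases hS0.eq_or_lt with h | h
        · rw [← h, mul_zero, Real.zero_rpow hp0.ne']
        · rw [Real.rpow_sub_one h.ne']; field_simp

theorem add_three_rpow_le {p x y z : ℝ} (hp : 0 ≤ p) (hx : 0 ≤ x) (hy : 0 ≤ y) (hz : 0 ≤ z) :
    (x + y + z) ^ p ≤ 3 ^ p * (x ^ p + y ^ p + z ^ p) := by
  have key : ∀ w, 0 ≤ w → x ≤ w → y ≤ w → z ≤ w → (x + y + z) ^ p ≤ 3 ^ p * w ^ p :=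
    fun w hw h1 h2 h3 ↦ by
      rw [← Real.mul_rpow (by norm_num) hw]
      exact Real.rpow_le_rpow (by positivity) (by linarith) hp
  have hx' := Real.rpow_nonneg hx p
  have hy' := Real.rpow_nonneg hy p
  have hz' := Real.rpow_nonneg hz p
  rcases le_total x y with h1 | h1
  · rcases le_total y z with h2 | h2
    · refine (key z hz (h1.trans h2) h2 le_rfl).trans ?_
      gcongr
      linarith
    · refine (key y hy h1 le_rfl h2).trans ?_
      gcongr
      linarith
  · rcases le_total x z with h2 | h2
    · refine (key z hz h2 (h1.trans h2) le_rfl).trans ?_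
      gcongr
      linarith
    · refine (key x hx le_rfl h1 h2).trans ?_
      gcongr
      linarith

/-! ### Decomposition across dyadic scales. -/

/-- A sequence of averaging operators `A` and a reverse martingale `e` such that `A t` is close to
the identity on the differences of `e` at dyadic scales above `t`, and small on those at dyadic
scales below `t`. -/
structure IsDyadicApproximation {X : Type*} [NormedAddCommGroup X] (p c : ℝ) (A : ℕ → X →+ X)
    (e : ℕ → X) : Prop where
  norm_le : ∀ t x, ‖A t x‖ ≤ ‖x‖
  norm_sub_le : ∀ t s : ℕ, 0 < t → t ≤ s → ∀ x, ‖A s x - A t x‖ ≤ 2 * ((s - t) / s) * ‖x‖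
  norm_diff_le : ∀ m t : ℕ, 0 < t →
    ‖A t (e m - e (m + 1))‖ ≤ 2 * (2 ^ (m + 1) / t) * ‖e m - e (m + 1)‖
  norm_sub_self_le : ∀ m t : ℕ, 0 < t → t ≤ 2 ^ m →
    ‖A t (e m) - e m‖ ≤ 2 * (t / 2 ^ m : ℝ) ^ p⁻¹ * ‖e m‖
  norm_diff_sub_self_le : ∀ m t : ℕ, 0 < t → t ≤ 2 ^ m →
    ‖A t (e m - e (m + 1)) - (e m - e (m + 1))‖
      ≤ 2 * (t / 2 ^ m : ℝ) ^ p⁻¹ * ‖e m - e (m + 1)‖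
  rpow_add_le : ∀ n k : ℕ, ‖e (n + k)‖ ^ p + c * ‖e n - e (n + k)‖ ^ p ≤ ‖e n‖ ^ p

/-- The differences of `e` up to the index `M`, completed by `e M`. -/
def truncatedDiff {X : Type*} [AddCommGroup X] (e : ℕ → X) (M m : ℕ) : X :=
  if m < M then e m - e (m + 1) else e M

theorem sum_Ico_truncatedDiff {X : Type*} [AddCommGroup X] (e : ℕ → X) {M n : ℕ} (hn : n ≤ M) :
    ∑ m ∈ Finset.Ico n (M + 1), truncatedDiff e M m = e n := by
  rw [Finset.sum_Ico_succ_top hn, Finset.sum_congr rfl (g := fun m ↦ -(e (m + 1) - e m))]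
  · rw [Finset.sum_neg_distrib, Finset.sum_Ico_sub _ hn]
    simp [truncatedDiff]
  · intro m hm
    rw [truncatedDiff, if_pos (Finset.mem_Ico.1 hm).2]
    abel

/-- The decay rate, in the distance of dyadic scales, of the interaction of averages with
martingale differences. -/
noncomputable def scaleDecay (p : ℝ) : ℝ := (1 / 2) ^ p⁻¹

/-- The decay rate that remains after interpolation with the smoothness of `t ↦ A t`. -/
noncomputable def interpolatedDecay (p : ℝ) : ℝ := scaleDecay p ^ (1 - p⁻¹)

section
variable {p : ℝ}

theorem scaleDecay_pos : 0 < scaleDecay p := by unfold scaleDecay; positivity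

theorem scaleDecay_le_one (hp : 2 ≤ p) : scaleDecay p ≤ 1 :=
  Real.rpow_le_one (by norm_num) (by norm_num) (by positivity)

theorem half_le_scaleDecay (hp : 2 ≤ p) : 1 / 2 ≤ scaleDecay p := by
  conv_lhs => rw [← Real.rpow_one (1 / 2 : ℝ)]
  exact Real.rpow_le_rpow_of_exponent_ge (by norm_num) (by norm_num)
    (inv_le_one_of_one_le₀ (by linarith))

theorem interpolatedDecay_pos : 0 < interpolatedDecay p := Real.rpow_pos_of_pos scaleDecay_pos _

theorem interpolatedDecay_lt_one (hp : 2 ≤ p) : interpolatedDecay p < 1 := by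
  have h : p⁻¹ < 1 := inv_lt_one_of_one_lt₀ (by linarith)
  exact Real.rpow_lt_one scaleDecay_pos.le
    (Real.rpow_lt_one (by norm_num) (by norm_num) (by positivity)) (by linarith)

theorem scaleDecay_le_interpolatedDecay (hp : 2 ≤ p) : scaleDecay p ≤ interpolatedDecay p := by
  conv_lhs => rw [← Real.rpow_one (scaleDecay p)]
  have : 0 < p⁻¹ := by positivity
  exact Real.rpow_le_rpow_of_exponent_ge scaleDecay_pos (scaleDecay_le_one hp) (by linarith)

theorem dyadic_ratio_rpow_le (hp : 2 ≤ p) {n m t : ℕ} (hnm : n ≤ m) (ht : t ≤ 2 ^ (n + 1)) :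
    (t / 2 ^ m : ℝ) ^ p⁻¹ ≤ 2 * scaleDecay p ^ (m - n) := by
  have hp0 : 0 < p⁻¹ := by positivity
  have h1 : (t / 2 ^ m : ℝ) ≤ 2 * (1 / 2) ^ (m - n) := by
    rw [div_le_iff₀ (by positivity), mul_assoc, one_div, inv_pow]
    obtain ⟨k, rfl⟩ := Nat.exists_eq_add_of_le hnm
    have : (t : ℝ) ≤ 2 ^ (n + 1) := by exact_mod_cast ht
    rw [Nat.add_sub_cancel_left, pow_add, mul_comm (2 ^ n), inv_mul_cancel_left₀ (by positivity)]
    rw [pow_succ] at this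
    linarith
  calc (t / 2 ^ m : ℝ) ^ p⁻¹ ≤ (2 * (1 / 2) ^ (m - n)) ^ p⁻¹ :=
        Real.rpow_le_rpow (by positivity) h1 hp0.le
    _ = 2 ^ p⁻¹ * scaleDecay p ^ (m - n) := by
        rw [Real.mul_rpow (by norm_num) (by positivity), scaleDecay, Real.rpow_pow_comm (by norm_num)]
    _ ≤ 2 * scaleDecay p ^ (m - n) := by
        have := scaleDecay_pos (p := p)
        gcongr
        conv_rhs => rw [← Real.rpow_one (2 : ℝ)]
        exact Real.rpow_le_rpow_of_exponent_le (by norm_num)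
          (inv_le_one_of_one_le₀ (by linarith))

theorem le_of_le_of_le_interpolate {z a b θ : ℝ} (hz : 0 ≤ z) (hθ0 : 0 ≤ θ) (hθ1 : θ ≤ 1)
    (ha : z ≤ a) (hb : z ≤ b) : z ≤ a ^ (1 - θ) * b ^ θ := by
  rcases hz.eq_or_lt with rfl | hz
  · exact mul_nonneg (Real.rpow_nonneg ha _) (Real.rpow_nonneg hb _)
  calc z = z ^ (1 - θ) * z ^ θ := by rw [← Real.rpow_add hz, sub_add_cancel, Real.rpow_one]
    _ ≤ a ^ (1 - θ) * b ^ θ := by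
      have ha0 : 0 ≤ a := hz.le.trans ha
      gcongr

end

namespace IsDyadicApproximation

variable {X : Type*} [NormedAddCommGroup X] {p c : ℝ} {A : ℕ → X →+ X} {e : ℕ → X}

theorem norm_low_le (h : IsDyadicApproximation p c A e) (hp : 2 ≤ p) {M n m t : ℕ} (hn : n ≤ M)
    (hm : m < n) (ht : 2 ^ n ≤ t) :
    ‖A t (truncatedDiff e M m)‖
      ≤ 4 * scaleDecay p ^ ((n - m) + (m - n)) * ‖truncatedDiff e M m‖ := by
  rw [truncatedDiff, if_pos (hm.trans_le hn)]
  have ht0 : 0 < t := (by positivity : 0 < 2 ^ n).trans_le ht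
  refine (h.norm_diff_le m t ht0).trans ?_
  gcongr ?_ * _
  have h1 : (2 ^ (m + 1) / t : ℝ) ≤ 2 * (1 / 2) ^ (n - m) := by
    have ht' : (2 : ℝ) ^ n ≤ t := by exact_mod_cast ht
    obtain ⟨k, rfl⟩ := Nat.exists_eq_add_of_le hm.le
    calc (2 ^ (m + 1) / t : ℝ) ≤ 2 ^ (m + 1) / 2 ^ (m + k) := by gcongr
      _ = 2 * (1 / 2) ^ (m + k - m) := by
        rw [Nat.add_sub_cancel_left, one_div, inv_pow, pow_add, pow_add]
        field_simp
  -- The rate `1 / 2` is weakened to `scaleDecay p` so that low and high scales share one kernel.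
  have h2 : (1 / 2 : ℝ) ^ (n - m) ≤ scaleDecay p ^ (n - m) :=
    pow_le_pow_left₀ (by norm_num) (half_le_scaleDecay hp) _
  rw [Nat.sub_eq_zero_of_le hm.le, add_zero]
  linarith

theorem norm_high_le (h : IsDyadicApproximation p c A e) (hp : 2 ≤ p) {M n m t : ℕ}
    (hm : n ≤ m) (hmM : m ≤ M) (ht0 : 0 < t) (ht : t < 2 ^ (n + 1)) :
    ‖A t (truncatedDiff e M m) - truncatedDiff e M m‖
      ≤ 4 * scaleDecay p ^ ((n - m) + (m - n)) * ‖truncatedDiff e M m‖ := by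
  -- For `m = n`, `t` may exceed `2 ^ m`, so only the contraction bound is available.
  rcases hm.eq_or_lt with rfl | hlt
  · rw [Nat.sub_self, pow_zero]
    refine (_root_.norm_sub_le _ _).trans ?_
    have := h.norm_le t (truncatedDiff e M n)
    linarith [norm_nonneg (truncatedDiff e M n)]
  have htm : t ≤ 2 ^ m := ht.le.trans (Nat.pow_le_pow_right (by norm_num) hlt)
  have h1 := dyadic_ratio_rpow_le hp hm ht.le
  have h2 : ‖A t (truncatedDiff e M m) - truncatedDiff e M m‖
      ≤ 2 * (t / 2 ^ m : ℝ) ^ p⁻¹ * ‖truncatedDiff e M m‖ := by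
    unfold truncatedDiff
    split_ifs with h3
    · exact h.norm_diff_sub_self_le m t ht0 htm
    · obtain rfl : m = M := by omega
      exact h.norm_sub_self_le m t ht0 htm
  refine h2.trans ?_
  gcongr ?_ * _
  rw [Nat.sub_eq_zero_of_le hm, zero_add]
  linarith

/-- Since `e n` is the sum of the pieces with `m ≥ n`, `A t` is compared with zero on lower pieces
and with the identity on the others. -/
theorem norm_sub_dyadic_le (h : IsDyadicApproximation p c A e) (hp : 2 ≤ p) {M n t : ℕ}
    (hn : n ≤ M) (ht : 2 ^ n ≤ t) (ht' : t < 2 ^ (n + 1)) :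
    ‖A t (e 0) - e n‖ ≤ ∑ m ∈ Finset.range (M + 1),
      4 * scaleDecay p ^ ((n - m) + (m - n)) * ‖truncatedDiff e M m‖ := by
  have ht0 : 0 < t := (by positivity : 0 < 2 ^ n).trans_le ht
  have h1 : A t (e 0) - e n = ∑ m ∈ Finset.range n, A t (truncatedDiff e M m)
      + ∑ m ∈ Finset.Ico n (M + 1), (A t (truncatedDiff e M m) - truncatedDiff e M m) := by
    rw [Finset.sum_sub_distrib, sum_Ico_truncatedDiff e hn, ← add_sub_assoc,
      Finset.sum_range_add_sum_Ico _ (by omega), ← map_sum, Finset.range_eq_Ico,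
      sum_Ico_truncatedDiff e (Nat.zero_le M)]
  rw [h1, ← Finset.sum_range_add_sum_Ico _ (by omega : n ≤ M + 1)]
  refine (norm_add_le _ _).trans (add_le_add ?_ ?_)
  · exact norm_sum_le_of_le _ fun m hm ↦ h.norm_low_le hp hn (Finset.mem_range.1 hm) ht
  · refine norm_sum_le_of_le _ fun m hm ↦ ?_
    rw [Finset.mem_Ico] at hm
    exact h.norm_high_le hp hm.1 (by omega) ht0 ht'

/-- Each piece obeys both the scale decay and the Lipschitz bound. Weight `p⁻¹` on the latter makes
the `p`-th power linear in `s - t`, hence additive over intervals, while some decay remains. -/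
theorem norm_sub_same_scale_le (h : IsDyadicApproximation p c A e) (hp : 2 ≤ p) {M n t s : ℕ}
    (hn : n ≤ M) (ht : 2 ^ n ≤ t) (hts : t ≤ s) (hs : s < 2 ^ (n + 1)) :
    ‖A s (e 0) - A t (e 0)‖ ≤ ((s - t) / 2 ^ n : ℝ) ^ p⁻¹ * ∑ m ∈ Finset.range (M + 1),
      8 * interpolatedDecay p ^ ((n - m) + (m - n)) * ‖truncatedDiff e M m‖ := by
  have ht0 : 0 < t := (by positivity : 0 < 2 ^ n).trans_le ht
  have hp0 : 0 < p := by linarith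
  have hθ0 : 0 < p⁻¹ := by positivity
  have hθ1 : p⁻¹ ≤ 1 := inv_le_one_of_one_le₀ (by linarith)
  have hst : (0 : ℝ) ≤ s - t := sub_nonneg.2 (by exact_mod_cast hts)
  have h1 : A s (e 0) - A t (e 0) = ∑ m ∈ Finset.range (M + 1),
      (A s (truncatedDiff e M m) - A t (truncatedDiff e M m)) := by
    rw [Finset.sum_sub_distrib, ← map_sum, ← map_sum, Finset.range_eq_Ico,
      sum_Ico_truncatedDiff e (Nat.zero_le M)]
  rw [h1, Finset.mul_sum]
  refine norm_sum_le_of_le _ fun m hm ↦ ?_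
  set g := truncatedDiff e M m with hg
  set k := (n - m) + (m - n) with hk
  set u := ((s - t) / 2 ^ n : ℝ) with hu
  have hu0 : 0 ≤ u := by positivity
  have hr := scaleDecay_pos (p := p)
  have hb : ‖A s g - A t g‖ ≤ 8 * (u * ‖g‖) := by
    refine (h.norm_sub_le t s ht0 hts g).trans ?_
    have : ((s - t) / s : ℝ) ≤ u := by
      have : (2 ^ n : ℝ) ≤ s := by exact_mod_cast ht.trans hts
      rw [hu]
      gcongr
    calc 2 * ((s - t) / s : ℝ) * ‖g‖ ≤ 2 * u * ‖g‖ := by gcongr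
      _ ≤ 8 * (u * ‖g‖) := by linarith [mul_nonneg hu0 (norm_nonneg g)]
  have ha : ‖A s g - A t g‖ ≤ 8 * (scaleDecay p ^ k * ‖g‖) := by
    rcases lt_or_ge m n with hmn | hmn
    · have h2 := h.norm_low_le hp hn hmn ht
      have h3 := h.norm_low_le hp hn hmn (ht.trans hts)
      refine (_root_.norm_sub_le _ _).trans ?_
      rw [← hg, ← hk] at h2 h3
      linarith
    · have hmM : m ≤ M := by rw [Finset.mem_range] at hm; omega
      have h2 := h.norm_high_le hp hmn hmM ht0 (hts.trans_lt hs)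
      have h3 := h.norm_high_le hp hmn hmM (ht0.trans_le hts) hs
      rw [← hg, ← hk] at h2 h3
      rw [← sub_sub_sub_cancel_right _ _ g]
      refine (_root_.norm_sub_le _ _).trans ?_
      linarith
  have h2 := le_of_le_of_le_interpolate (norm_nonneg _) hθ0.le hθ1 ha hb
  refine h2.trans (le_of_eq ?_)
  have hpow : (scaleDecay p ^ k) ^ (1 - p⁻¹) = interpolatedDecay p ^ k := by
    rw [interpolatedDecay, Real.rpow_pow_comm hr.le]
  rw [Real.mul_rpow (by norm_num) (by positivity),
    Real.mul_rpow (x := 8) (y := u * _) (by norm_num) (by positivity),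
    Real.mul_rpow (pow_nonneg hr.le k) (norm_nonneg _), Real.mul_rpow hu0 (norm_nonneg _), hpow]
  have h8 : ∀ z : ℝ, 0 ≤ z → z ^ (1 - p⁻¹) * z ^ p⁻¹ = z := fun z hz ↦ by
    rw [← Real.rpow_add' hz (by simp), sub_add_cancel, Real.rpow_one]
  calc _ = u ^ p⁻¹ * ((8 ^ (1 - p⁻¹) * 8 ^ p⁻¹) * interpolatedDecay p ^ k
        * (‖g‖ ^ (1 - p⁻¹) * ‖g‖ ^ p⁻¹)) := by ring
    _ = _ := by rw [h8 _ (by norm_num), h8 _ (norm_nonneg _)]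

/-- The error of approximating the averages in the dyadic scale `n` by `e n`. -/
noncomputable def scaleError (p : ℝ) (e : ℕ → X) (M n : ℕ) : ℝ :=
  ∑ m ∈ Finset.range (M + 1),
    8 * interpolatedDecay p ^ ((n - m) + (m - n)) * ‖truncatedDiff e M m‖

theorem scaleError_nonneg (M n : ℕ) : 0 ≤ scaleError p e M n := by
  have := interpolatedDecay_pos (p := p)
  exact Finset.sum_nonneg fun _ _ ↦ by positivity

theorem norm_sub_dyadic_le_scaleError (h : IsDyadicApproximation p c A e) (hp : 2 ≤ p)
    {M n t : ℕ} (hn : n ≤ M) (ht : 2 ^ n ≤ t) (ht' : t < 2 ^ (n + 1)) :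
    ‖A t (e 0) - e n‖ ≤ scaleError p e M n := by
  refine (h.norm_sub_dyadic_le hp hn ht ht').trans ?_
  have h1 := scaleDecay_pos (p := p)
  have h2 := scaleDecay_le_interpolatedDecay hp
  unfold scaleError
  gcongr
  norm_num

/-- Schur's test reduces this to the pieces: the differences telescope with factor `c⁻¹`, and the
last piece `e M` accounts for the `+ 1`. -/
theorem sum_scaleError_rpow_le (h : IsDyadicApproximation p c A e) (hp : 2 ≤ p) (hc : 0 < c)
    (M : ℕ) : ∑ n ∈ Finset.range (M + 1), scaleError p e M n ^ p
      ≤ (8 * (2 / (1 - interpolatedDecay p))) ^ p * ((c⁻¹ + 1) * ‖e 0‖ ^ p) := by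
  have hρ0 := interpolatedDecay_pos (p := p)
  have hρ1 := interpolatedDecay_lt_one hp
  have h1 := schur_test (p := p) (S := 8 * (2 / (1 - interpolatedDecay p))) (by linarith)
    (w := fun n m ↦ 8 * interpolatedDecay p ^ ((n - m) + (m - n))) (fun _ _ ↦ by positivity)
    (fun n m ↦ by rw [add_comm]) (Finset.range (M + 1))
    (fun n ↦ by
      rw [← Finset.mul_sum]
      exact mul_le_mul_of_nonneg_left (sum_pow_abs_sub_le hρ0.le hρ1 n _) (by norm_num))
    (δ := fun m ↦ ‖truncatedDiff e M m‖) (fun _ ↦ norm_nonneg _)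
  refine h1.trans (mul_le_mul_of_nonneg_left ?_ (Real.rpow_nonneg (mul_nonneg (by norm_num)
    (div_nonneg (by norm_num) (by linarith))) _))
  have h2 : ∀ m, ‖e m - e (m + 1)‖ ^ p ≤ c⁻¹ * (‖e m‖ ^ p - ‖e (m + 1)‖ ^ p) := fun m ↦ by
    rw [inv_mul_eq_div, le_div_iff₀ hc]
    linarith [h.rpow_add_le m 1]
  have h3 : ‖e M‖ ^ p ≤ ‖e 0‖ ^ p := by
    have h4 := h.rpow_add_le 0 M
    rw [zero_add] at h4
    have : 0 ≤ c * ‖e 0 - e M‖ ^ p := by positivity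
    linarith
  rw [Finset.sum_range_succ]
  have h5 : ∑ m ∈ Finset.range M, ‖truncatedDiff e M m‖ ^ p
      ≤ c⁻¹ * (‖e 0‖ ^ p - ‖e M‖ ^ p) := by
    rw [← Finset.sum_range_sub' (fun m ↦ ‖e m‖ ^ p), Finset.mul_sum]
    refine Finset.sum_le_sum fun m hm ↦ ?_
    rw [truncatedDiff, if_pos (Finset.mem_range.1 hm)]
    exact h2 m
  have h6 : 0 ≤ c⁻¹ * ‖e M‖ ^ p := by positivity
  rw [truncatedDiff, if_neg (lt_irrefl M)]
  linarith

/-! ### Telescoping the variation. -/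

/-- A potential whose increments dominate the `p`-th powers of the increments of `t ↦ A t (e 0)`. -/
noncomputable def potential (p c : ℝ) (e : ℕ → X) (M t : ℕ) : ℝ :=
  3 ^ p * ((∑ j ∈ Finset.range (Nat.log 2 t), scaleError p e M j ^ p
      + (t / 2 ^ Nat.log 2 t - 1) * scaleError p e M (Nat.log 2 t) ^ p)
    + ∑ j ∈ Finset.range (Nat.log 2 t), scaleError p e M j ^ p
    + ∑ j ∈ Finset.range (Nat.log 2 t + 1), scaleError p e M j ^ p
    + c⁻¹ * (‖e 0‖ ^ p - ‖e (Nat.log 2 t)‖ ^ p))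

theorem dyadic_fraction_mem {t : ℕ} (ht : 0 < t) :
    0 ≤ (t / 2 ^ Nat.log 2 t - 1 : ℝ) ∧ (t / 2 ^ Nat.log 2 t - 1 : ℝ) ≤ 1 := by
  have h1 : (2 ^ Nat.log 2 t : ℝ) ≤ t := by exact_mod_cast Nat.pow_log_le_self 2 ht.ne'
  have h2 : (t : ℝ) ≤ 2 * 2 ^ Nat.log 2 t := by
    have := (Nat.lt_pow_succ_log_self (b := 2) (by norm_num) t).le
    rw [Nat.pow_succ'] at this
    exact_mod_cast this
  have h3 : (0 : ℝ) < 2 ^ Nat.log 2 t := by positivity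
  rw [sub_nonneg, one_le_div h3, sub_le_iff_le_add, div_le_iff₀ h3]
  exact ⟨h1, by linarith⟩

theorem rpow_norm_sub_le_potential (h : IsDyadicApproximation p c A e) (hp : 2 ≤ p) (hc : 0 < c)
    {M t s : ℕ} (ht : 0 < t) (hts : t ≤ s) (hs : Nat.log 2 s ≤ M) :
    ‖A s (e 0) - A t (e 0)‖ ^ p ≤ potential p c e M s - potential p c e M t := by
  have hp0 : 0 < p := by linarith
  have hs0 : 0 < s := ht.trans_le hts
  have hnn : Nat.log 2 t ≤ Nat.log 2 s := Nat.log_mono_right hts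
  have ht1 := Nat.pow_log_le_self 2 ht.ne'
  have ht2 := Nat.lt_pow_succ_log_self (b := 2) (by norm_num) t
  have hs1 := Nat.pow_log_le_self 2 hs0.ne'
  have hs2 := Nat.lt_pow_succ_log_self (b := 2) (by norm_num) s
  have hft := dyadic_fraction_mem ht
  have hfs := dyadic_fraction_mem hs0
  have h3p : (1 : ℝ) ≤ 3 ^ p := Real.one_le_rpow (by norm_num) hp0.le
  have hQ : ∀ j, 0 ≤ scaleError p e M j ^ p := fun j ↦ Real.rpow_nonneg (scaleError_nonneg M j) p
  unfold potential
  set n := Nat.log 2 t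
  set n' := Nat.log 2 s
  rcases hnn.eq_or_lt with heq | hlt
  -- Within one scale only the fractional term of the potential moves, by exactly `(s - t) / 2 ^ n`
  -- times the error.
  · rw [← heq] at hs1 hs2 hs ⊢
    have h1 := h.norm_sub_same_scale_le hp hs ht1 hts hs2
    have hst : (0 : ℝ) ≤ s - t := sub_nonneg.2 (by exact_mod_cast hts)
    have h2 := Real.rpow_le_rpow (norm_nonneg _) h1 hp0.le
    change _ ≤ (_ * scaleError p e M n) ^ p at h2
    rw [Real.mul_rpow (by positivity) (scaleError_nonneg M n),
      Real.rpow_inv_rpow (by positivity) hp0.ne'] at h2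
    have h3 : (0 : ℝ) ≤ (s - t) / 2 ^ n * scaleError p e M n ^ p :=
      mul_nonneg (by positivity) (hQ n)
    calc _ ≤ (s - t) / 2 ^ n * scaleError p e M n ^ p := h2
      _ ≤ 3 ^ p * ((s - t) / 2 ^ n * scaleError p e M n ^ p) := le_mul_of_one_le_left h3 h3p
      _ = _ := by ring
  -- Across scales the increment passes through `e n` and `e n'`. The second sum pays for the error
  -- at `n`, the third for that at `n'`, and the norm drop for `e n - e n'`; the fractional part
  -- does not decrease.
  · have h1 := h.norm_sub_dyadic_le_scaleError hp (hnn.trans hs) ht1 ht2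
    have h2 := h.norm_sub_dyadic_le_scaleError hp hs hs1 hs2
    have h3 : ‖A s (e 0) - A t (e 0)‖
        ≤ scaleError p e M n' + ‖e n - e n'‖ + scaleError p e M n := by
      have : A s (e 0) - A t (e 0)
          = (A s (e 0) - e n') + -(e n - e n') + -(A t (e 0) - e n) := by abel
      rw [this]
      refine (norm_add₃_le).trans ?_
      rw [norm_neg, norm_neg]
      linarith
    have h4 := (Real.rpow_le_rpow (norm_nonneg _) h3 hp0.le).trans
      (add_three_rpow_le hp0.le (scaleError_nonneg M n') (norm_nonneg _) (scaleError_nonneg M n))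
    have h5 : ‖e n - e n'‖ ^ p ≤ c⁻¹ * (‖e n‖ ^ p - ‖e n'‖ ^ p) := by
      obtain ⟨k, hk⟩ := Nat.exists_eq_add_of_le hnn
      rw [inv_mul_eq_div, le_div_iff₀ hc, hk]
      linarith [h.rpow_add_le n k]
    have h6 : ∑ j ∈ Finset.range (n + 1), scaleError p e M j ^ p
        ≤ ∑ j ∈ Finset.range n', scaleError p e M j ^ p :=
      Finset.sum_le_sum_of_subset_of_nonneg (Finset.range_subset_range.2 hlt) fun j _ _ ↦ hQ j
    have h7 := Finset.sum_range_succ (fun j ↦ scaleError p e M j ^ p) n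
    have h8 := Finset.sum_range_succ (fun j ↦ scaleError p e M j ^ p) n'
    have h9 := mul_le_of_le_one_left (hQ n) hft.2
    have h10 := mul_nonneg hfs.1 (hQ n')
    refine h4.trans ?_
    rw [← mul_sub]
    refine mul_le_mul_of_nonneg_left ?_ (by linarith)
    linarith

/-- The constant in the `p`-variation inequality. -/
noncomputable def variationConstant (p c : ℝ) : ℝ :=
  3 ^ p * (3 * ((8 * (2 / (1 - interpolatedDecay p))) ^ p * (c⁻¹ + 1)) + c⁻¹)

theorem potential_le (h : IsDyadicApproximation p c A e) (hp : 2 ≤ p) (hc : 0 < c)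
    {M t : ℕ} (ht : 0 < t) (htM : Nat.log 2 t ≤ M) :
    potential p c e M t ≤ variationConstant p c * ‖e 0‖ ^ p := by
  have hQ : ∀ j, 0 ≤ scaleError p e M j ^ p := fun j ↦ Real.rpow_nonneg (scaleError_nonneg M j) p
  have h1 := h.sum_scaleError_rpow_le hp hc M
  have h2 := mul_le_of_le_one_left (hQ (Nat.log 2 t)) (dyadic_fraction_mem ht).2
  have h3 : ∑ j ∈ Finset.range (Nat.log 2 t + 1), scaleError p e M j ^ p
        ≤ ∑ j ∈ Finset.range (M + 1), scaleError p e M j ^ p :=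
    Finset.sum_le_sum_of_subset_of_nonneg (Finset.range_subset_range.2 (by omega)) fun j _ _ ↦ hQ j
  have h4 := Finset.sum_range_succ (fun j ↦ scaleError p e M j ^ p) (Nat.log 2 t)
  have h5 : 0 ≤ c⁻¹ * ‖e (Nat.log 2 t)‖ ^ p := by positivity
  have h6 := hQ (Nat.log 2 t)
  unfold potential variationConstant
  rw [mul_assoc]
  refine mul_le_mul_of_nonneg_left ?_ (by positivity)
  linarith

theorem potential_nonneg (h : IsDyadicApproximation p c A e) (hc : 0 < c)
    {M t : ℕ} (ht : 0 < t) : 0 ≤ potential p c e M t := by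
  have hQ : ∀ j, 0 ≤ scaleError p e M j ^ p := fun j ↦ Real.rpow_nonneg (scaleError_nonneg M j) p
  have h1 := mul_nonneg (dyadic_fraction_mem ht).1 (hQ (Nat.log 2 t))
  have h2 : ∀ N, 0 ≤ ∑ j ∈ Finset.range N, scaleError p e M j ^ p :=
    fun N ↦ Finset.sum_nonneg fun j _ ↦ hQ j
  have h3 : 0 ≤ ‖e 0‖ ^ p - ‖e (Nat.log 2 t)‖ ^ p := by
    have h4 := h.rpow_add_le 0 (Nat.log 2 t)
    rw [zero_add] at h4
    have : 0 ≤ c * ‖e 0 - e (Nat.log 2 t)‖ ^ p := by positivity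
    linarith
  have h4 := h2 (Nat.log 2 t)
  have h5 := h2 (Nat.log 2 t + 1)
  have h6 := mul_nonneg (inv_pos.2 hc).le h3
  unfold potential
  exact mul_nonneg (by positivity) (by linarith)

theorem sum_rpow_norm_sub_le (h : IsDyadicApproximation p c A e) (hp : 2 ≤ p) (hc : 0 < c)
    {t : ℕ → ℕ} (ht : Monotone t) (ht0 : ∀ k, 0 < t k) (R : ℕ) :
    ∑ k ∈ Finset.range R, ‖A (t (k + 1)) (e 0) - A (t k) (e 0)‖ ^ p
      ≤ variationConstant p c * ‖e 0‖ ^ p := by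
  -- The truncation covers every scale met up to `R`; the final bound does not depend on it.
  set M := Nat.log 2 (t R)
  calc _ ≤ ∑ k ∈ Finset.range R, (potential p c e M (t (k + 1)) - potential p c e M (t k)) :=
        Finset.sum_le_sum fun k hk ↦ h.rpow_norm_sub_le_potential hp hc (ht0 k)
          (ht (Nat.le_succ k)) (Nat.log_mono_right (ht (Finset.mem_range.1 hk)))
    _ = potential p c e M (t R) - potential p c e M (t 0) :=
        Finset.sum_range_sub (fun k ↦ potential p c e M (t k)) R
    _ ≤ variationConstant p c * ‖e 0‖ ^ p := by
        linarith [h.potential_le hp hc (ht0 R) (le_refl M), h.potential_nonneg hc (M := M) (ht0 0)]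

end IsDyadicApproximation

/-! ### Application to the shift on `ℓ^p(ℤ; B)`. -/

theorem variationConstant_pos {p c : ℝ} (hp : 2 ≤ p) (hc : 0 < c) :
    0 < IsDyadicApproximation.variationConstant p c := by
  have : 0 < 1 - interpolatedDecay p := sub_pos.2 (interpolatedDecay_lt_one hp)
  unfold IsDyadicApproximation.variationConstant
  positivity

/-- The ergodic average as an additive map. -/
noncomputable def lpErgodicAverageHom {B : Type*} [NormedAddCommGroup B] [NormedSpace ℝ B]
    {P : ℝ≥0∞} (t : ℕ) : lp (fun _ : ℤ => B) P →+ lp (fun _ : ℤ => B) P :=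
  AddMonoidHom.mk' (lpErgodicAverage t) (lpErgodicAverage_add t)

theorem exists_isDyadicApproximation {B : Type*} [NormedAddCommGroup B] [NormedSpace ℝ B]
    {p K : ℝ} [Fact (1 ≤ ENNReal.ofReal p)] (hp : 2 ≤ p) (hK : 0 < K)
    (hB : IsModulusOfUniformConvexity B (fun ε => K * ε ^ p))
    (f : lp (fun _ : ℤ => B) (ENNReal.ofReal p)) :
    ∃ e : ℕ → lp (fun _ : ℤ => B) (ENNReal.ofReal p), e 0 = f ∧
      IsDyadicApproximation p (2 * convexityConstant p K)
        lpErgodicAverageHom e := by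
  have hp0 : 0 < p := by linarith
  choose e he _ using fun n : ℕ ↦ exists_blockAverage (by linarith) (2 ^ n) f
  have hconst : ∀ n x, e n x = e n ((2 ^ n : ℕ) * (x / (2 ^ n : ℕ))) := fun n x ↦ by
    have := block_ediv (x / (2 ^ n : ℕ)) (NeZero.pos (2 ^ n))
    rw [Nat.cast_zero, add_zero] at this
    rw [he, he, this]
  have hconst' : ∀ n x, (e n - e (n + 1)) x
      = (e n - e (n + 1)) ((2 ^ n : ℕ) * (x / (2 ^ n : ℕ))) := fun n x ↦ by
    -- Dyadic blocks are nested: the start of the fine block of `x` lies in the coarse block of `x`.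
    have h1 : (((2 ^ n : ℕ) * (x / (2 ^ n : ℕ)) : ℤ)) / (2 ^ (n + 1) : ℕ)
        = x / (2 ^ (n + 1) : ℕ) := by
      have := block_ediv (x / (2 ^ n : ℕ)) (NeZero.pos (2 ^ n))
      rw [Nat.cast_zero, add_zero] at this
      rw [pow_succ, Nat.cast_mul, ← Int.ediv_ediv_of_nonneg (by positivity),
        ← Int.ediv_ediv_of_nonneg (by positivity), this]
    simp only [lp.coeFn_sub, Pi.sub_apply]
    rw [← hconst n x, he (n + 1), he (n + 1), h1]
  have hzero : ∀ n (q : ℤ), ∑ i ∈ Finset.range (2 ^ (n + 1)),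
      (e n - e (n + 1)) ((2 ^ (n + 1) : ℕ) * q + i) = 0 := fun n q ↦ by
    have h1 := sum_block_blockAverage (NeZero.pos (2 ^ n)) (he n) 2 q
    have h2 := sum_block_blockAverage (NeZero.pos (2 ^ (n + 1))) (he (n + 1)) 1 q
    rw [← pow_succ] at h1
    rw [mul_one] at h2
    simp only [lp.coeFn_sub, Pi.sub_apply]
    rw [Finset.sum_sub_distrib, h1, h2, sub_self]
  refine ⟨e, ?_, ?_, ?_, ?_, ?_, ?_, ?_⟩
  · ext x
    rw [he]
    simp
  · exact fun t x ↦ norm_lpErgodicAverage_le hp0 t x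
  · exact fun t s ht hts x ↦ norm_lpErgodicAverage_sub_le hp0 ht hts x
  · intro m t ht
    have := norm_lpErgodicAverage_le_of_block_sum_eq_zero (by linarith) (2 ^ (m + 1)) ht _ (hzero m)
    push_cast at this
    exact this
  · intro m t ht htm
    have := norm_lpErgodicAverage_sub_self_le_of_block_const hp0 (2 ^ m) ht htm _ (hconst m)
    push_cast at this
    exact this
  · intro m t ht htm
    have := norm_lpErgodicAverage_sub_self_le_of_block_const hp0 (2 ^ m) ht htm _ (hconst' m)
    push_cast at this
    exact this
  · intro n k
    have hk := he (n + k)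
    rw [pow_add] at hk
    have : NeZero (2 ^ n * 2 ^ k) := ⟨by positivity⟩
    exact norm_blockAverage_rpow_add_le hp hK hB (2 ^ n) (2 ^ k) f (e n) (e (n + k)) (he n) hk

theorem theorem6 (p K : ℝ) (hp : 2 ≤ p) (hK : 0 < K) :
    ∃ C : ℝ, 0 < C ∧
      ∀ (B : Type*) [NormedAddCommGroup B] [NormedSpace ℝ B] [CompleteSpace B],
        IsModulusOfUniformConvexity B (fun ε => K * ε ^ p) →
        ∀ t : ℕ → ℕ, Monotone t → (∀ k, 0 < t k) →
        ∀ f : lp (fun _ : ℤ => B) (ENNReal.ofReal p),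
          Summable (fun k : ℕ => ‖lpErgodicAverage (t (k + 1)) f - lpErgodicAverage (t k) f‖ ^ p) ∧
          ∑' k : ℕ, ‖lpErgodicAverage (t (k + 1)) f - lpErgodicAverage (t k) f‖ ^ p
            ≤ C * ‖f‖ ^ p := by
  have hc : 0 < 2 * convexityConstant p K := mul_pos two_pos (convexityConstant_pos hK)
  refine ⟨_, variationConstant_pos hp hc, fun B _ _ _ hB t ht ht0 f ↦ ?_⟩
  have : Fact (1 ≤ ENNReal.ofReal p) := ⟨ENNReal.one_le_ofReal.2 (by linarith)⟩
  obtain ⟨e, rfl, he⟩ := exists_isDyadicApproximation hp hK hB f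
  have h1 := he.sum_rpow_norm_sub_le hp hc ht ht0
  have h2 : ∀ k, 0 ≤ ‖lpErgodicAverage (t (k + 1)) (e 0) - lpErgodicAverage (t k) (e 0)‖ ^ p :=
    fun k ↦ Real.rpow_nonneg (norm_nonneg _) p
  exact ⟨summable_of_sum_range_le h2 h1, Real.tsum_le_of_sum_range_le h2 h1⟩
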